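/- For $n\in\mathbb N$ let $H_n$ be the Hermite polynomial given by $H_0(t)=1$, $H_1(t)=2t$, $H_n(t)=2t\,H_{n-1}(t)-2(n-1)H_{n-2}(t)$ for $n\ge 2$, let $t_{n,1}<t_{n,2}<\dots<t_{n,n}$ be its $n$ real zeros, and let $\phi_{m,n}(x,y)=H_m(x)H_n(y)\exp\left(-\frac{x^2+y^2}{2}\right)$ on $\mathbb R^2$. The nodal set of a function $u$ on $\mathbb R^2$ is the closure of $\{u=0\}$. Proposition. Let $n$ be odd. The nodal set of $\phi_{n,0}-\phi_{0,n}$ is the union of the diagonal $\{x=y\}$ and of $\frac{n-1}{2}$ pairwise disjoint simple closed curves. Each of these curves crosses both the diagonal and the anti-diagonal $\{x+y=0\}$. The union of the curves meets the diagonal exactly at the $n-1$ points $(t_{n-1,i},t_{n-1,i})$, $1\le i\le n-1$, and the anti-diagonal exactly at the $n-1$ points $(t_{n,i},-t_{n,i})$ with $1\le i\le n$ and $t_{n,i}\ne 0$; at each of these points the curve through it crosses the line, i.e. passes from one side of the line to the other. -/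

import Mathlib

open Set Filter Topology

noncomputable section

/-- The (physicists') Hermite polynomials, in Szegő's normalization:
`H₀ = 1`, `H₁ = 2t`, `H_{n+2} = 2 t H_{n+1} - 2 (n+1) H_n`. -/
def hermiteH : ℕ → Polynomial ℝ
  | 0 => 1
  | 1 => 2 * Polynomial.X
  | n + 2 => 2 * Polynomial.X * hermiteH (n + 1) - 2 * ((n : Polynomial ℝ) + 1) * hermiteH n

/-- The eigenfunctions `φ_{m,n}(x,y) = H_m(x) H_n(y) exp(-(x²+y²)/2)` of `-Δ + |x|²` on the
plane. -/
def phi (m n : ℕ) (p : ℝ × ℝ) : ℝ :=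
  (hermiteH m).eval p.1 * (hermiteH n).eval p.2 * Real.exp (-(p.1 ^ 2 + p.2 ^ 2) / 2)

/-- The nodal set of a function on the plane: the closure of its zero set. -/
def nodalSet (u : ℝ × ℝ → ℝ) : Set (ℝ × ℝ) :=
  closure {p | u p = 0}

/-- `t` lists the real zeros of `H_m` in increasing order, and there are exactly `m` of them. -/
structure IsHermiteZeros (m : ℕ) (t : Fin m → ℝ) : Prop where
  strictMono : StrictMono t
  range_eq : range t = {x : ℝ | (hermiteH m).eval x = 0}

/-- A simple closed curve in the plane, given as a `2π`-periodic parametrization. -/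
structure IsSimpleClosedCurve (γ : ℝ → ℝ × ℝ) : Prop where
  continuous : Continuous γ
  periodic : Function.Periodic γ (2 * Real.pi)
  injOn : InjOn γ (Ico 0 (2 * Real.pi))

/-- The curve `γ` crosses the line `{f = 0}` at the point `p`: it passes through `p`, which lies
on the line, and there goes from one side of the line to the other. -/
def CrossesAt (γ : ℝ → ℝ × ℝ) (f : ℝ × ℝ → ℝ) (p : ℝ × ℝ) : Prop :=
  ∃ s : ℝ, γ s = p ∧ f p = 0 ∧
    (((∀ᶠ u in 𝓝[<] s, f (γ u) < 0) ∧ (∀ᶠ u in 𝓝[>] s, 0 < f (γ u))) ∨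
     ((∀ᶠ u in 𝓝[<] s, 0 < f (γ u)) ∧ (∀ᶠ u in 𝓝[>] s, f (γ u) < 0)))

end

/-! Write `n + 1` for the odd index. Up to the positive exponential, the function is `H_{n+1}(x) -
H_{n+1}(y)`, which is `x - y` times a chord quotient. On the line of direction `θ` this quotient is
a polynomial in the signed radius `r`, even in `r`, of exact degree `n`, with coefficients
continuous in `θ` (`chordPoly`).

The main point is that its roots are simple for every `θ`. Off the diagonal, a multiple root would
give `x ≠ y` with `f x = f y` and `x f' x = y f' y`, where `f = H_{n+1}`. If `|x| < |y|`, the energy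
`f² + f'² / (2(n+1))`, strictly increasing in `|x|`, forces `f'(x)² < f'(y)²`, a contradiction. If
`y = -x`, oddness makes `x` a common zero of `H_n` and `H_{n+1}`. On the diagonal the quotient is
`f'`, whose zeros are those of `H_n`, all simple.

For `θ = π/4` all `n` roots are real, being rescaled zeros of `H_n`. Simple real roots can neither
appear nor disappear as `θ` varies, so every direction has `n` real roots, and sorted they are
continuous in `θ` (`exists_continuous_sortedRoots`). They are nonzero and symmetric about `0`; each
of the `n / 2` positive ones traces a closed polar curve as `θ` makes a full turn. Such a curve
meets every ray from the origin, and it crosses a line through the origin because its angle does. -/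

/-! ### Hermite polynomials: derivative, degree, parity -/

open Polynomial in
lemma hermiteH_derivative (n : ℕ) :
    derivative (hermiteH (n + 1)) = 2 * ((n : ℝ[X]) + 1) * hermiteH n := by
  induction n using Nat.twoStepInduction with
  | zero => simp [hermiteH, derivative_mul]
  | one =>
    simp only [hermiteH, derivative_mul, derivative_sub, derivative_X, derivative_one,
      derivative_ofNat, derivative_add, derivative_natCast]
    push_cast
    ring
  | more n ih1 ih2 =>
    have h3 : hermiteH (n + 2 + 1) = 2 * X * hermiteH (n + 2)
        - 2 * (((n + 1 : ℕ) : ℝ[X]) + 1) * hermiteH (n + 1) := rfl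
    have h2 : hermiteH (n + 2) = 2 * X * hermiteH (n + 1)
        - 2 * ((n : ℝ[X]) + 1) * hermiteH n := rfl
    rw [h3]
    simp only [derivative_mul, derivative_sub, derivative_X, derivative_one,
      derivative_ofNat, derivative_add, derivative_natCast, ih1, ih2]
    rw [h2]
    push_cast
    ring

open Polynomial in
lemma hermiteH_degree (n : ℕ) : (hermiteH n).degree = n := by
  induction n using Nat.twoStepInduction with
  | zero => simp [hermiteH]
  | one =>
    rw [hermiteH, show (2 : ℝ[X]) = C 2 from rfl, degree_C_mul_X two_ne_zero]; rfl
  | more n ih1 ih2 =>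
    have hA : (2 * X * hermiteH (n + 1)).degree = ((n + 2 : ℕ) : WithBot ℕ) := by
      rw [degree_mul, ih2, show (2 : ℝ[X]) = C 2 from rfl, degree_C_mul_X two_ne_zero]
      push_cast
      ring
    have hB : (2 * ((n : ℝ[X]) + 1) * hermiteH n).degree < (2 * X * hermiteH (n + 1)).degree := by
      rw [hA, show (2 * ((n : ℝ[X]) + 1)) = C (2 * ((n : ℝ) + 1)) by
          simp only [map_mul, map_add, map_natCast, map_one, map_ofNat],
        degree_C_mul (by positivity), ih1]
      exact_mod_cast (by omega : n < n + 2)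
    have h2 : hermiteH (n + 2) = 2 * X * hermiteH (n + 1)
        - 2 * ((n : ℝ[X]) + 1) * hermiteH n := rfl
    rw [h2, degree_sub_eq_left_of_degree_lt hB, hA]

lemma hermiteH_ne_zero (n : ℕ) : hermiteH n ≠ 0 := by
  intro h
  have := hermiteH_degree n
  simp [h] at this

lemma hermiteH_natDegree (n : ℕ) : (hermiteH n).natDegree = n :=
  Polynomial.natDegree_eq_of_degree_eq_some (hermiteH_degree n)

open Polynomial in
lemma hermiteH_eval_rec (n : ℕ) (x : ℝ) : (hermiteH (n + 2)).eval x =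
    2 * x * (hermiteH (n + 1)).eval x - 2 * ((n : ℝ) + 1) * (hermiteH n).eval x := by
  simp [hermiteH]

lemma hermiteH_eval_neg (n : ℕ) (x : ℝ) :
    (hermiteH n).eval (-x) = (-1) ^ n * (hermiteH n).eval x := by
  induction n using Nat.twoStepInduction with
  | zero => simp [hermiteH]
  | one => simp [hermiteH]
  | more n ih1 ih2 => rw [hermiteH_eval_rec, hermiteH_eval_rec, ih1, ih2]; ring

/-! ### Zeros of Hermite polynomials are real and simple -/

/-- Consecutive Hermite polynomials have no common zero. -/
lemma hermiteH_no_common_zero (n : ℕ) (x : ℝ) (h : (hermiteH n).eval x = 0)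
    (h' : (hermiteH (n + 1)).eval x = 0) : False := by
  induction n with
  | zero => simp [hermiteH] at h
  | succ n ih =>
    refine ih ?_ h
    rw [hermiteH_eval_rec, h] at h'
    have : (n : ℝ) + 1 ≠ 0 := by positivity
    simpa [this] using h'

/-- A quantitative form of the absence of zeros in the upper half plane
(the Christoffel–Darboux identity at `z` and `conj z`). -/
lemma hermiteH_im_pos (n : ℕ) (z : ℂ) (hz : 0 < z.im) :
    0 < (Polynomial.aeval z (hermiteH (n + 1)) *
      (starRingEnd ℂ) (Polynomial.aeval z (hermiteH n))).im := by
  have htwo : Polynomial.aeval z (2 : Polynomial ℝ) = 2 := map_ofNat _ 2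
  induction n with
  | zero => simpa [hermiteH, htwo] using hz
  | succ n ih =>
    have hr : Polynomial.aeval z (hermiteH (n + 2)) = 2 * z * Polynomial.aeval z (hermiteH (n + 1))
        - 2 * ((n : ℂ) + 1) * Polynomial.aeval z (hermiteH n) := by
      simp [hermiteH, htwo]
    rw [hr]
    generalize Polynomial.aeval z (hermiteH (n + 1)) = a at *
    generalize Polynomial.aeval z (hermiteH n) = b at *
    -- `2 z a conj a` contributes `2 Im z |a|²`, and `-Im (b conj a) = Im (a conj b)` brings in the
    -- induction hypothesis.
    have h1 : ((2 * z * a - 2 * ((n : ℂ) + 1) * b) * (starRingEnd ℂ) a).im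
        = 2 * z.im * (a.re ^ 2 + a.im ^ 2)
          + 2 * ((n : ℝ) + 1) * (a * (starRingEnd ℂ) b).im := by
      simp
      ring
    rw [h1]
    positivity

/-- A complex zero off the real axis, or its conjugate, lies in the upper half plane, where
`hermiteH_im_pos` excludes zeros. -/
lemma hermiteH_splits (n : ℕ) : (hermiteH n).Splits := by
  rcases n with _ | n
  · simp [hermiteH]
  refine Polynomial.Splits.of_splits_map (algebraMap ℝ ℂ) (IsAlgClosed.splits _) ?_
  intro z hz
  have hz0 : Polynomial.aeval z (hermiteH (n + 1)) = 0 := by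
    have := (Polynomial.mem_roots'.1 hz).2
    rwa [Polynomial.IsRoot, Polynomial.eval_map_algebraMap] at this
  have him : z.im = 0 := by
    rcases lt_trichotomy z.im 0 with h | h | h
    · have hc : Polynomial.aeval ((starRingEnd ℂ) z) (hermiteH (n + 1)) = 0 := by
        rw [Polynomial.aeval_conj, hz0, map_zero]
      have := hermiteH_im_pos n ((starRingEnd ℂ) z) (by simpa using h)
      simp [hc] at this
    · exact h
    · have := hermiteH_im_pos n z h
      simp [hz0] at this
  exact ⟨z.re, by apply Complex.ext <;> simp [him]⟩

/-- Since `H_{n+1}'` is a multiple of `H_n`, a double zero would be shared by consecutive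
polynomials. -/
lemma hermiteH_roots_nodup (n : ℕ) : (hermiteH n).roots.Nodup := by
  rw [Multiset.nodup_iff_count_le_one]
  intro x
  rw [Polynomial.count_roots]
  by_contra h
  push Not at h
  obtain ⟨h1, h2⟩ := (Polynomial.one_lt_rootMultiplicity_iff_isRoot (hermiteH_ne_zero n)).1 h
  rcases n with _ | n
  · simp [hermiteH] at h1
  · rw [hermiteH_derivative] at h2
    have : (n : ℝ) + 1 ≠ 0 := by positivity
    exact hermiteH_no_common_zero n x (by simpa [this] using h2) h1

lemma exists_isHermiteZeros (n : ℕ) : ∃ t : Fin n → ℝ, IsHermiteZeros n t := by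
  have hc : (hermiteH n).roots.toFinset.card = n := by
    rw [Multiset.toFinset_card_of_nodup (hermiteH_roots_nodup n),
      ← (hermiteH_splits n).natDegree_eq_card_roots, hermiteH_natDegree]
  refine ⟨(hermiteH n).roots.toFinset.orderEmbOfFin hc, OrderEmbedding.strictMono _, ?_⟩
  rw [Finset.range_orderEmbOfFin]
  ext x
  simp [hermiteH_ne_zero n]

/-! ### Energy monotonicity and transversality along rays -/

section Energy

variable (n : ℕ)

lemma hasDerivAt_hermiteH (x : ℝ) : HasDerivAt (fun x => (hermiteH (n + 1)).eval x)
    (2 * ((n : ℝ) + 1) * (hermiteH n).eval x) x := by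
  have := (hermiteH (n + 1)).hasDerivAt x
  rw [hermiteH_derivative] at this
  simpa using this

/-- The energy `H_{n+1}² + H_{n+1}'² / (2(n+1))`, which increases with `|x|`. -/
noncomputable def hermiteEnergy (x : ℝ) : ℝ :=
  (hermiteH (n + 1)).eval x ^ 2 + 2 * ((n : ℝ) + 1) * (hermiteH n).eval x ^ 2

/-- In the derivative of the energy, the Hermite equation `f'' = 2 x f' - 2(n+1) f` cancels the
terms in `f f'`; the recurrence plays its role here. -/
lemma hasDerivAt_hermiteEnergy (x : ℝ) :
    HasDerivAt (hermiteEnergy n) (8 * ((n : ℝ) + 1) * x * (hermiteH n).eval x ^ 2) x := by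
  have h1 := hasDerivAt_hermiteH n x
  rcases n with _ | n
  · have h := (h1.pow 2).add_const (2 * ((0 : ℕ) + 1 : ℝ))
    refine (h.congr_of_eventuallyEq (Eventually.of_forall fun y => ?_)).congr_deriv ?_
    · simp [hermiteEnergy, hermiteH]
    · simp [hermiteH]
      ring
  · have h2 := hasDerivAt_hermiteH n x
    have h := (h1.pow 2).add ((h2.pow 2).const_mul (2 * (((n + 1 : ℕ) : ℝ) + 1)))
    refine (h.congr_of_eventuallyEq (Eventually.of_forall fun y => ?_)).congr_deriv ?_
    · simp [hermiteEnergy]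
    · rw [hermiteH_eval_rec]
      push_cast
      ring

lemma hermiteEnergy_strictMonoOn : StrictMonoOn (hermiteEnergy n) (Ici 0) := by
  have hmono : MonotoneOn (hermiteEnergy n) (Ici 0) := by
    refine monotoneOn_of_deriv_nonneg (convex_Ici 0)
      (fun x _ => (hasDerivAt_hermiteEnergy n x).continuousAt.continuousWithinAt)
      (fun x _ => (hasDerivAt_hermiteEnergy n x).differentiableAt.differentiableWithinAt) ?_
    intro x hx
    rw [interior_Ici] at hx
    rw [(hasDerivAt_hermiteEnergy n x).deriv]
    have : 0 < x := hx
    positivity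
  intro x hx y hy hxy
  refine lt_of_le_of_ne (hmono hx hy hxy.le) fun heq => ?_
  -- otherwise the energy is constant on the interval, so `H_n` has infinitely many zeros
  have hz : ∀ z ∈ Ioo x y, (hermiteH n).eval z = 0 := by
    intro z hz
    have hz0 : 0 < z := lt_of_le_of_lt hx hz.1
    have hev : hermiteEnergy n =ᶠ[𝓝 z] fun _ => hermiteEnergy n x := by
      filter_upwards [Ioo_mem_nhds hz.1 hz.2] with u hu
      have hu0 : (0 : ℝ) ≤ u := le_trans hx hu.1.le
      exact le_antisymm (heq ▸ hmono hu0 hy hu.2.le) (hmono hx hu0 hu.1.le)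
    have hd := (hasDerivAt_hermiteEnergy n z).unique
      ((hasDerivAt_const z (hermiteEnergy n x)).congr_of_eventuallyEq hev)
    have h8 : 8 * ((n : ℝ) + 1) * z ≠ 0 := by positivity
    simpa [h8] using hd
  refine hermiteH_ne_zero n (Polynomial.eq_zero_of_infinite_isRoot _ ?_)
  exact (Ioo_infinite hxy).mono fun z h => hz z h

lemma hermiteEnergy_neg (x : ℝ) : hermiteEnergy n (-x) = hermiteEnergy n x := by
  simp only [hermiteEnergy, hermiteH_eval_neg, mul_pow, ← pow_mul]
  rw [mul_comm n, mul_comm (n + 1), pow_mul, pow_mul]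
  norm_num

lemma hermiteEnergy_abs (x : ℝ) : hermiteEnergy n |x| = hermiteEnergy n x := by
  rcases abs_choice x with h | h <;> rw [h]
  exact hermiteEnergy_neg n x

/-- Transversality along rays: `H_{n+1}` and `x H_{n+1}'` do not take the same values at points of
different absolute value. -/
lemma hermiteH_transversal_of_abs_lt {x y : ℝ} (hxy : |x| < |y|)
    (h : (hermiteH (n + 1)).eval x = (hermiteH (n + 1)).eval y)
    (h' : x * (hermiteH n).eval x = y * (hermiteH n).eval y) : False := by
  have hlt := hermiteEnergy_strictMonoOn n (abs_nonneg x) (abs_nonneg y) hxy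
  rw [hermiteEnergy_abs, hermiteEnergy_abs, hermiteEnergy, hermiteEnergy, h] at hlt
  have hn : (0 : ℝ) < 2 * ((n : ℝ) + 1) := by positivity
  have hlt' : (hermiteH n).eval x ^ 2 < (hermiteH n).eval y ^ 2 :=
    lt_of_mul_lt_mul_left (by linarith) hn.le
  have hsq : x ^ 2 < y ^ 2 := sq_lt_sq.2 hxy
  have h2 : x ^ 2 * (hermiteH n).eval x ^ 2 = y ^ 2 * (hermiteH n).eval y ^ 2 := by
    rw [← mul_pow, ← mul_pow, h']
  have h3 := mul_lt_mul'' hsq hlt' (sq_nonneg _) (sq_nonneg _)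
  linarith

lemma hermiteH_transversal (hn : Odd (n + 1)) {x y : ℝ} (hxy : x ≠ y)
    (h : (hermiteH (n + 1)).eval x = (hermiteH (n + 1)).eval y)
    (h' : x * (hermiteH n).eval x = y * (hermiteH n).eval y) : False := by
  rcases lt_trichotomy |x| |y| with hlt | heq | hlt
  · exact hermiteH_transversal_of_abs_lt n hlt h h'
  -- The energy says nothing here; oddness of `H_{n+1}` and evenness of `H_n` force a common zero
  -- instead.
  · have hy : y = -x := by
      rcases abs_eq_abs.1 heq with e | e
      · exact absurd e hxy
      · linarith
    subst hy
    have hx : x ≠ 0 := by rintro rfl; simp at hxy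
    have hev : Even n := by
      rcases Nat.even_or_odd n with e | o
      · exact e
      · exact absurd (o.add_odd odd_one) (Nat.not_even_iff_odd.2 hn)
    rw [hermiteH_eval_neg, hn.neg_one_pow] at h
    rw [hermiteH_eval_neg, hev.neg_one_pow] at h'
    have h1 : x * (hermiteH n).eval x = 0 := by linarith
    exact hermiteH_no_common_zero n x ((mul_eq_zero.1 h1).resolve_left hx) (by linarith)
  · exact hermiteH_transversal_of_abs_lt n hlt h.symm h'.symm

end Energy

/-! ### Continuous dependence of simple real roots on a parameter -/

section SortedRoots

open Polynomial

lemma eq_of_strictMono_of_range_eq {d : ℕ} {f g : Fin d → ℝ} (hf : StrictMono f)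
    (hg : StrictMono g) (h : range f = range g) : f = g :=
  (hf.range_inj hg).1 h

/-- A polynomial changes sign at a simple root. -/
lemma eventually_mul_neg_of_simple_root {p : ℝ[X]} {x : ℝ} (h : p.eval x = 0)
    (h' : (derivative p).eval x ≠ 0) :
    ∀ᶠ δ in 𝓝[>] (0 : ℝ), p.eval (x - δ) * p.eval (x + δ) < 0 := by
  obtain ⟨g, rfl⟩ := dvd_iff_isRoot.2 h
  have hg : g.eval x ≠ 0 := by simpa [derivative_mul] using h'
  have hc : Continuous fun δ : ℝ => g.eval (x - δ) * g.eval (x + δ) := by fun_prop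
  have h0 : ∀ᶠ δ in 𝓝 (0 : ℝ), 0 < g.eval (x - δ) * g.eval (x + δ) := by
    refine hc.continuousAt.eventually (lt_mem_nhds ?_)
    simpa using mul_self_pos.2 hg
  filter_upwards [nhdsWithin_le_nhds h0, self_mem_nhdsWithin] with δ h1 (h2 : 0 < δ)
  have : ((X - C x) * g).eval (x - δ) * ((X - C x) * g).eval (x + δ)
      = -(δ ^ 2 * (g.eval (x - δ) * g.eval (x + δ))) := by
    simp
    ring
  rw [this, neg_lt_zero]
  positivity

/-- `r` lists in increasing order the roots of a polynomial of degree `d`. -/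
def IsSortedRoots {d : ℕ} (p : ℝ[X]) (r : Fin d → ℝ) : Prop :=
  StrictMono r ∧ ∀ i, p.eval (r i) = 0

variable {d : ℕ}

lemma IsSortedRoots.range_eq {p : ℝ[X]} {r : Fin d → ℝ} (h : IsSortedRoots p r)
    (hp : p ≠ 0) (hd : p.natDegree = d) : range r = {x | p.eval x = 0} := by
  have hsub : Finset.univ.image r ⊆ p.roots.toFinset := by
    intro x hx
    obtain ⟨i, -, rfl⟩ := Finset.mem_image.1 hx
    simpa [hp] using h.2 i
  have hcard : p.roots.toFinset.card ≤ (Finset.univ.image r).card := by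
    rw [Finset.card_image_of_injective _ h.1.injective, Finset.card_fin]
    exact (Multiset.toFinset_card_le _).trans (hd ▸ p.card_roots')
  have heq := Finset.eq_of_subset_of_card_le hsub hcard
  ext x
  have := Finset.ext_iff.1 heq x
  simpa [hp] using this

lemma IsSortedRoots.eval_eq {p : ℝ[X]} {r : Fin d → ℝ} (h : IsSortedRoots p r)
    (hp : p ≠ 0) (hd : p.natDegree = d) (x : ℝ) :
    p.eval x = p.coeff d * ∏ i, (x - r i) := by
  have hle : Finset.univ.val.map r ≤ p.roots := by
    rw [Multiset.le_iff_subset ((Multiset.nodup_map_iff_of_injective h.1.injective).2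
      Finset.univ.nodup)]
    intro y hy
    obtain ⟨i, -, rfl⟩ := Multiset.mem_map.1 hy
    simpa [hp] using h.2 i
  have heq : Finset.univ.val.map r = p.roots := by
    refine Multiset.eq_of_le_of_card_le hle ?_
    simpa [hd] using p.card_roots'
  have hs : p.Splits := by
    rw [splits_iff_card_roots, ← heq, hd]
    simp
  rw [hs.eval_eq_prod_roots, ← heq, leadingCoeff, hd, Multiset.map_map]
  rfl

variable {P : ℝ → ℝ[X]}

lemma continuous_eval_of_continuous_coeff (hdeg : ∀ θ, (P θ).natDegree = d)
    (hcont : ∀ k, Continuous fun θ => (P θ).coeff k) {x : ℝ → ℝ} (hx : Continuous x) :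
    Continuous fun θ => (P θ).eval (x θ) := by
  have : (fun θ => (P θ).eval (x θ))
      = fun θ => ∑ k ∈ Finset.range (d + 1), (P θ).coeff k * x θ ^ k := by
    ext θ
    rw [eval_eq_sum_range, hdeg]
  rw [this]
  fun_prop

/-- Simple real roots persist and move continuously. -/
lemma eventually_exists_sortedRoots_near (hdeg : ∀ θ, (P θ).natDegree = d)
    (hcont : ∀ k, Continuous fun θ => (P θ).coeff k)
    (hsimple : ∀ θ x, (P θ).eval x = 0 → (derivative (P θ)).eval x ≠ 0)
    {θ : ℝ} {r : Fin d → ℝ} (hr : IsSortedRoots (P θ) r) {ε : ℝ} (hε : 0 < ε) :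
    ∀ᶠ θ' in 𝓝 θ, ∃ r' : Fin d → ℝ, IsSortedRoots (P θ') r' ∧ ∀ i, |r' i - r i| < ε := by
  have h1 : ∀ᶠ δ in 𝓝[>] (0 : ℝ), ∀ i, (P θ).eval (r i - δ) * (P θ).eval (r i + δ) < 0 :=
    eventually_all.2 fun i =>
      eventually_mul_neg_of_simple_root (hr.2 i) (hsimple θ _ (hr.2 i))
  have h2 : ∀ᶠ δ in 𝓝[>] (0 : ℝ), ∀ i j, i < j → r i + δ < r j - δ := by
    refine eventually_all.2 fun i => eventually_all.2 fun j => ?_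
    by_cases hij : i < j
    · have hlt := hr.1 hij
      filter_upwards [Ioo_mem_nhdsGT (show (0 : ℝ) < (r j - r i) / 2 by linarith)] with δ hδ _
      linarith [hδ.2]
    · exact Eventually.of_forall fun _ h => absurd h hij
  -- The intervals of radius `δ < ε` about the roots are disjoint and show a sign change between
  -- their ends. The sign change persists for nearby parameters, and the intermediate value theorem
  -- puts a root in each.
  obtain ⟨δ, hδ1, hδ2, hδ⟩ := (h1.and (h2.and (Ioo_mem_nhdsGT hε))).exists
  have h3 : ∀ᶠ θ' in 𝓝 θ, ∀ i, (P θ').eval (r i - δ) * (P θ').eval (r i + δ) < 0 := by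
    refine eventually_all.2 fun i => ?_
    have hc : Continuous fun θ' => (P θ').eval (r i - δ) * (P θ').eval (r i + δ) :=
      (continuous_eval_of_continuous_coeff hdeg hcont continuous_const).mul
        (continuous_eval_of_continuous_coeff hdeg hcont continuous_const)
    exact hc.continuousAt.eventually (gt_mem_nhds (hδ1 i))
  filter_upwards [h3] with θ' hθ'
  have hroot : ∀ i, ∃ x ∈ Ioo (r i - δ) (r i + δ), (P θ').eval x = 0 := by
    intro i
    have hle : r i - δ ≤ r i + δ := by linarith [hδ.1]
    have hc : ContinuousOn (fun x => (P θ').eval x) (Icc (r i - δ) (r i + δ)) :=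
      (P θ').continuous.continuousOn
    rcases mul_neg_iff.1 (hθ' i) with h | h
    · exact intermediate_value_Ioo' hle hc ⟨h.2, h.1⟩
    · exact intermediate_value_Ioo hle hc h
  choose r' hr' hr0 using hroot
  refine ⟨r', ⟨fun i j hij => ?_, hr0⟩, fun i => ?_⟩
  · linarith [(hr' i).2, (hr' j).1, hδ2 i j hij]
  · rw [abs_lt]
    constructor <;> linarith [(hr' i).1, (hr' i).2, hδ.2]

/-- The Cauchy bound is continuous in the parameter, so the roots stay bounded and a subsequence
converges. The factorization passes to the limit, where two coinciding roots would make a square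
factor, against simplicity. -/
lemma isClosed_setOf_exists_sortedRoots (hdeg : ∀ θ, (P θ).natDegree = d)
    (hcont : ∀ k, Continuous fun θ => (P θ).coeff k) (hne : ∀ θ, P θ ≠ 0)
    (hsimple : ∀ θ x, (P θ).eval x = 0 → (derivative (P θ)).eval x ≠ 0) :
    IsClosed {θ | ∃ r : Fin d → ℝ, IsSortedRoots (P θ) r} := by
  have hlead : ∀ θ, (P θ).coeff d ≠ 0 := fun θ => by
    rw [← hdeg θ]
    exact leadingCoeff_ne_zero.2 (hne θ)
  refine IsSeqClosed.isClosed fun u θ hu hlim => ?_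
  choose r hr using hu
  have hcb : Continuous fun θ => (cauchyBound (P θ) : ℝ) := by
    have : (fun θ => (cauchyBound (P θ) : ℝ)) = fun θ =>
        ((((Finset.range d).sup fun k => ‖(P θ).coeff k‖₊) / ‖(P θ).coeff d‖₊ + 1 : NNReal) : ℝ) := by
      ext θ
      rw [cauchyBound, leadingCoeff, hdeg]
    rw [this]
    refine NNReal.continuous_coe.comp (Continuous.add (Continuous.div₀ ?_ ?_ ?_) continuous_const)
    · exact Continuous.finset_sup_apply fun k _ => (hcont k).nnnorm
    · exact (hcont d).nnnorm
    · exact fun θ => by simpa using hlead θ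
  obtain ⟨B, hB⟩ := ((hcb.tendsto θ).comp hlim).bddAbove_range
  have hbound : ∀ k, r k ∈ Metric.closedBall (0 : Fin d → ℝ) B := by
    intro k
    have hB0 : (cauchyBound (P (u k)) : ℝ) ≤ B := hB ⟨k, rfl⟩
    rw [mem_closedBall_zero_iff, pi_norm_le_iff_of_nonneg (le_trans (by positivity) hB0)]
    intro i
    exact le_trans (NNReal.coe_le_coe.2
      (IsRoot.norm_lt_cauchyBound (hne (u k)) ((hr k).2 i)).le) hB0
  obtain ⟨a, -, φ, hφ, ha⟩ := tendsto_subseq_of_bounded Metric.isBounded_closedBall hbound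
  have hai : ∀ i, Tendsto (fun k => r (φ k) i) atTop (𝓝 (a i)) := fun i =>
    (tendsto_pi_nhds.1 ha) i
  have huφ : Tendsto (fun k => u (φ k)) atTop (𝓝 θ) := hlim.comp hφ.tendsto_atTop
  have hmono : Monotone a := fun i j hij =>
    le_of_tendsto_of_tendsto' (hai i) (hai j) fun k => (hr (φ k)).1.monotone hij
  have hprod : ∀ x, (P θ).eval x = (P θ).coeff d * ∏ i, (x - a i) := by
    intro x
    have h1 : Tendsto (fun k => (P (u (φ k))).eval x) atTop (𝓝 ((P θ).eval x)) :=
      ((continuous_eval_of_continuous_coeff hdeg hcont continuous_const).tendsto θ).comp huφ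
    have h2 : Tendsto (fun k => (P (u (φ k))).coeff d * ∏ i, (x - r (φ k) i)) atTop
        (𝓝 ((P θ).coeff d * ∏ i, (x - a i))) :=
      (((hcont d).tendsto θ).comp huφ).mul
        (tendsto_finsetProd _ fun i _ => (hai i).const_sub x)
    refine tendsto_nhds_unique h1 (h2.congr fun k => ?_)
    exact ((hr (φ k)).eval_eq (hne _) (hdeg _) x).symm
  have ha0 : ∀ i, (P θ).eval (a i) = 0 := fun i => by
    rw [hprod, Finset.prod_eq_zero (Finset.mem_univ i) (sub_self _), mul_zero]
  refine ⟨a, hmono.strictMono_of_injective fun i j hij => ?_, ha0⟩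
  by_contra hne'
  refine hsimple θ (a i) (ha0 i) ?_
  have hP : P θ = C ((P θ).coeff d) * ∏ i, (X - C (a i)) := by
    refine Polynomial.funext fun x => ?_
    rw [hprod x]
    simp [eval_prod]
  have hdvd : (X - C (a i)) ^ 2 ∣ P θ := by
    rw [hP]
    refine Dvd.dvd.mul_left ?_ _
    rw [← Finset.mul_prod_erase Finset.univ _ (Finset.mem_univ i),
      ← Finset.mul_prod_erase (Finset.univ.erase i) _
        (Finset.mem_erase.2 ⟨Ne.symm hne', Finset.mem_univ j⟩), ← mul_assoc, hij, ← sq]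
    exact dvd_mul_right _ _
  obtain ⟨q, hq⟩ := hdvd
  rw [hq]
  simp [derivative_mul, derivative_pow]

/-- A continuous family of polynomials of constant degree, all of whose real roots are simple, and
one of which has only real roots, has continuous sorted root functions. -/
theorem exists_continuous_sortedRoots (hdeg : ∀ θ, (P θ).natDegree = d)
    (hcont : ∀ k, Continuous fun θ => (P θ).coeff k) (hne : ∀ θ, P θ ≠ 0)
    (hsimple : ∀ θ x, (P θ).eval x = 0 → (derivative (P θ)).eval x ≠ 0)
    {θ₀ : ℝ} {r₀ : Fin d → ℝ} (h₀ : IsSortedRoots (P θ₀) r₀) :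
    ∃ ρ : ℝ → Fin d → ℝ, Continuous ρ ∧ ∀ θ, IsSortedRoots (P θ) (ρ θ) := by
  have hclopen : IsClopen {θ | ∃ r : Fin d → ℝ, IsSortedRoots (P θ) r} := by
    refine ⟨isClosed_setOf_exists_sortedRoots hdeg hcont hne hsimple, ?_⟩
    rw [isOpen_iff_mem_nhds]
    rintro θ ⟨r, hr⟩
    filter_upwards [eventually_exists_sortedRoots_near hdeg hcont hsimple hr one_pos]
      with θ' ⟨r', hr', _⟩
    exact ⟨r', hr'⟩
  have huniv := hclopen.eq_univ ⟨θ₀, r₀, h₀⟩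
  have hall : ∀ θ, ∃ r : Fin d → ℝ, IsSortedRoots (P θ) r := fun θ =>
    (Set.ext_iff.1 huniv θ).2 trivial
  choose ρ hρ using hall
  refine ⟨ρ, continuous_pi fun i => continuous_iff_continuousAt.2 fun θ => ?_, hρ⟩
  rw [Metric.continuousAt_iff']
  intro ε hε
  filter_upwards [eventually_exists_sortedRoots_near hdeg hcont hsimple (hρ θ) hε]
    with θ' ⟨r', hr', hnear⟩
  -- The sorted list of roots is unique, so the nearby roots are the chosen ones.
  have : ρ θ' = r' := eq_of_strictMono_of_range_eq (hρ θ').1 hr'.1 <| by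
    rw [(hρ θ').range_eq (hne _) (hdeg _), hr'.range_eq (hne _) (hdeg _)]
  rw [this, Real.dist_eq]
  exact hnear i

end SortedRoots

/-! ### The chord quotient along a ray -/

section ChordPolynomial

open Polynomial

/-- The sum `∑ aⁱ bʲ` over `i + j = k`, which equals `(a^(k+1) - b^(k+1)) / (a - b)`. -/
noncomputable def powerChord (k : ℕ) (a b : ℝ) : ℝ :=
  ∑ i ∈ Finset.range (k + 1), a ^ i * b ^ (k - i)

lemma powerChord_mul_sub (k : ℕ) (a b : ℝ) :
    powerChord k a b * (a - b) = a ^ (k + 1) - b ^ (k + 1) := by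
  simpa [powerChord] using (Commute.all a b).geom_sum₂_mul (k + 1)

lemma powerChord_self (k : ℕ) (a : ℝ) : powerChord k a a = (k + 1) * a ^ k := by
  rw [powerChord, Finset.sum_congr rfl (g := fun _ => a ^ k)]
  · simp
  · intro i hi
    rw [← pow_add]
    congr 1
    have := Finset.mem_range.1 hi
    omega

lemma powerChord_smul (k : ℕ) (r a b : ℝ) :
    powerChord k (a * r) (b * r) = powerChord k a b * r ^ k := by
  rw [powerChord, powerChord, Finset.sum_mul]
  refine Finset.sum_congr rfl fun i hi => ?_
  have hk : k = i + (k - i) := by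
    have := Finset.mem_range.1 hi
    omega
  rw [mul_pow, mul_pow]
  conv_rhs => rw [hk, pow_add r, ← hk]
  ring

/-- Odd powers are injective on `ℝ`. This keeps the leading coefficient of the chord polynomial
nonzero in every direction, so no root escapes to infinity. -/
lemma powerChord_ne_zero {k : ℕ} (hk : Odd (k + 1)) {a b : ℝ} (h : a ≠ 0 ∨ b ≠ 0) :
    powerChord k a b ≠ 0 := by
  by_cases hab : a = b
  · subst hab
    have ha : a ≠ 0 := by simpa using h
    rw [powerChord_self]
    positivity
  · intro h0
    have := powerChord_mul_sub k a b
    rw [h0, zero_mul] at this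
    exact hab (hk.strictMono_pow.injective (sub_eq_zero.1 this.symm))

/-- The polynomial `(f(a r) - f(b r)) / ((a - b) r)` in `r`. -/
noncomputable def chordPoly (f : ℝ[X]) (a b : ℝ) : ℝ[X] :=
  ∑ k ∈ Finset.range f.natDegree, monomial k (f.coeff (k + 1) * powerChord k a b)

variable (f : ℝ[X]) (a b r : ℝ)

lemma chordPoly_coeff (k : ℕ) : (chordPoly f a b).coeff k = f.coeff (k + 1) * powerChord k a b := by
  rw [chordPoly, finsetSum_coeff]
  simp only [coeff_monomial]
  rw [Finset.sum_ite_eq']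
  split_ifs with h
  · rfl
  · rw [coeff_eq_zero_of_natDegree_lt, zero_mul]
    have : ¬ k < f.natDegree := by simpa using h
    omega

lemma chordPoly_eval : (chordPoly f a b).eval r =
    ∑ k ∈ Finset.range f.natDegree, f.coeff (k + 1) * powerChord k a b * r ^ k := by
  simp [chordPoly, eval_finsetSum]

lemma chordPoly_mul_sub : (a - b) * r * (chordPoly f a b).eval r =
    f.eval (a * r) - f.eval (b * r) := by
  rw [chordPoly_eval, eval_eq_sum_range, eval_eq_sum_range, Finset.sum_range_succ',
    Finset.sum_range_succ', Finset.mul_sum]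
  simp only [pow_zero, add_sub_add_right_eq_sub]
  rw [← Finset.sum_sub_distrib]
  refine Finset.sum_congr rfl fun k _ => ?_
  have := powerChord_mul_sub k a b
  calc _ = f.coeff (k + 1) * (powerChord k a b * (a - b)) * r ^ (k + 1) := by ring
    _ = _ := by rw [this, mul_pow, mul_pow]; ring

lemma chordPoly_self : (chordPoly f a a).eval r = (derivative f).eval (a * r) := by
  rw [chordPoly_eval, derivative_eval, sum_over_range _ (by simp), Finset.sum_range_succ']
  simp only [powerChord_self]
  simp [mul_pow, mul_assoc]

/-- Links the two readings of the quotient: a function of the point of the plane (value at `1`) and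
a polynomial in the radius for a fixed direction. -/
lemma chordPoly_scale : (chordPoly f (a * r) (b * r)).eval 1 = (chordPoly f a b).eval r := by
  simp [chordPoly_eval, powerChord_smul, mul_assoc]

lemma chordPoly_eval_zero : (chordPoly f a b).eval 0 = f.coeff 1 := by
  rw [← coeff_zero_eq_eval_zero, chordPoly_coeff]
  simp [powerChord]

lemma chordPoly_natDegree (hf : Odd f.natDegree) (h : a ≠ 0 ∨ b ≠ 0) :
    (chordPoly f a b).natDegree = f.natDegree - 1 := by
  have hpos := hf.pos
  refine natDegree_eq_of_le_of_coeff_ne_zero ?_ ?_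
  · refine natDegree_sum_le_of_forall_le _ _ fun k hk => (natDegree_monomial_le _).trans ?_
    have := Finset.mem_range.1 hk
    omega
  · have he : f.natDegree - 1 + 1 = f.natDegree := by omega
    rw [chordPoly_coeff, he]
    refine mul_ne_zero (leadingCoeff_ne_zero.2 ?_) (powerChord_ne_zero (he ▸ hf) h)
    rintro rfl
    simp at hpos

lemma chordPoly_derivative :
    (a - b) * ((chordPoly f a b).eval r + r * (derivative (chordPoly f a b)).eval r) =
      a * (derivative f).eval (a * r) - b * (derivative f).eval (b * r) := by
  have h1 : HasDerivAt (fun r => (a - b) * r * (chordPoly f a b).eval r)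
      ((a - b) * 1 * (chordPoly f a b).eval r
        + (a - b) * r * (derivative (chordPoly f a b)).eval r) r :=
    ((hasDerivAt_id r).const_mul (a - b)).mul ((chordPoly f a b).hasDerivAt r)
  have hc : ∀ c : ℝ, HasDerivAt (fun r => f.eval (c * r)) (c * (derivative f).eval (c * r)) r := by
    intro c
    have := (f.hasDerivAt (c * r)).comp r ((hasDerivAt_id r).const_mul c)
    refine this.congr_deriv ?_
    ring
  have h2 := (hc a).sub (hc b)
  have h3 := h1.unique (h2.congr_of_eventuallyEq
    (Eventually.of_forall fun r => chordPoly_mul_sub f a b r))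
  linarith

lemma chordPoly_self_derivative :
    (derivative (chordPoly f a a)).eval r = a * (derivative (derivative f)).eval (a * r) := by
  have h1 := (chordPoly f a a).hasDerivAt r
  have h2 : HasDerivAt (fun r => (derivative f).eval (a * r))
      ((derivative (derivative f)).eval (a * r) * (a * 1)) r :=
    ((derivative f).hasDerivAt (a * r)).comp r ((hasDerivAt_id r).const_mul a)
  rw [h1.unique (h2.congr_of_eventuallyEq (Eventually.of_forall fun r => chordPoly_self f a r))]
  ring

end ChordPolynomial

/-! ### Simple roots of the Hermite chord polynomial -/

section HermiteChord

open Polynomial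

variable {n : ℕ}

/-- This coefficient is `H_{n+1}'(0)`, a multiple of `H_n(0)`, and `0` is already a zero of the odd
`H_{n+1}`. It is also the constant term of every chord polynomial, so the curves avoid the origin.
-/
lemma hermiteH_coeff_one_ne_zero (hn : Odd (n + 1)) : (hermiteH (n + 1)).coeff 1 ≠ 0 := by
  have hd : (derivative (hermiteH (n + 1))).eval 0 = (hermiteH (n + 1)).coeff 1 := by
    rw [← coeff_zero_eq_eval_zero, coeff_derivative]
    simp
  rw [← hd, (hermiteH (n + 1)).hasDerivAt 0 |>.unique (hasDerivAt_hermiteH n 0)]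
  have h0 : (hermiteH (n + 1)).eval 0 = 0 := by
    have := hermiteH_eval_neg (n + 1) 0
    rw [hn.neg_one_pow, neg_zero] at this
    linarith
  have : (hermiteH n).eval 0 ≠ 0 := fun h => hermiteH_no_common_zero n 0 h h0
  positivity

lemma eval_derivative_hermiteH (x : ℝ) : (derivative (hermiteH (n + 1))).eval x =
    2 * ((n : ℝ) + 1) * (hermiteH n).eval x :=
  ((hermiteH (n + 1)).hasDerivAt x).unique (hasDerivAt_hermiteH n x)

lemma chordPoly_hermiteH_self_eq_zero_iff (a r : ℝ) :
    (chordPoly (hermiteH (n + 1)) a a).eval r = 0 ↔ (hermiteH n).eval (a * r) = 0 := by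
  have : (n : ℝ) + 1 ≠ 0 := by positivity
  rw [chordPoly_self, eval_derivative_hermiteH]
  simp [this]

lemma chordPoly_hermiteH_neg (hn : Odd (n + 1)) {a b r : ℝ}
    (h : (chordPoly (hermiteH (n + 1)) a b).eval r = 0) :
    (chordPoly (hermiteH (n + 1)) a b).eval (-r) = 0 := by
  rcases eq_or_ne r 0 with rfl | hr
  · simpa using h
  by_cases hab : a = b
  · subst hab
    rw [chordPoly_hermiteH_self_eq_zero_iff] at h ⊢
    rw [mul_neg, hermiteH_eval_neg, h, mul_zero]
  · have h1 := chordPoly_mul_sub (hermiteH (n + 1)) a b r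
    have h2 := chordPoly_mul_sub (hermiteH (n + 1)) a b (-r)
    rw [mul_neg a, mul_neg b, hermiteH_eval_neg, hermiteH_eval_neg, hn.neg_one_pow] at h2
    rw [h, mul_zero] at h1
    have h3 : (a - b) * -r * eval (-r) (chordPoly (hermiteH (n + 1)) a b) = 0 := by
      rw [h2]
      linarith
    exact (mul_eq_zero.1 h3).resolve_left
      (mul_ne_zero (sub_ne_zero.2 hab) (neg_ne_zero.2 hr))

/-- The zeros of `H_{n+1}(x) - H_{n+1}(y)` off the diagonal are simple along rays. -/
lemma chordPoly_hermiteH_simple (hn : Odd (n + 1)) {a b r : ℝ} (hab : a ≠ 0 ∨ b ≠ 0)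
    (h : (chordPoly (hermiteH (n + 1)) a b).eval r = 0) :
    (derivative (chordPoly (hermiteH (n + 1)) a b)).eval r ≠ 0 := by
  intro h'
  have hr : r ≠ 0 := by
    rintro rfl
    exact hermiteH_coeff_one_ne_zero hn ((chordPoly_eval_zero _ a b) ▸ h)
  have hn0 : 2 * ((n : ℝ) + 1) ≠ 0 := by positivity
  -- On the diagonal a double root would be a double zero of `H_n`; off it, a point where the radial
  -- derivative of `H_{n+1}(x) - H_{n+1}(y)` vanishes too.
  by_cases heq : a = b
  · subst heq
    have ha : a ≠ 0 := by simpa using hab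
    rw [chordPoly_hermiteH_self_eq_zero_iff] at h
    rw [chordPoly_self_derivative] at h'
    have h2 : (derivative (hermiteH n)).eval (a * r) ≠ 0 := by
      rcases n with _ | n
      · simp [hermiteH] at h
      · rw [eval_derivative_hermiteH]
        have : (hermiteH n).eval (a * r) ≠ 0 := fun h0 => hermiteH_no_common_zero n _ h0 h
        positivity
    refine mul_ne_zero ha ?_ h'
    rw [hermiteH_derivative, show (2 * ((n : ℝ[X]) + 1)) = C (2 * ((n : ℝ) + 1)) by
      simp only [map_mul, map_add, map_natCast, map_one, map_ofNat], derivative_C_mul, eval_C_mul]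
    exact mul_ne_zero hn0 h2
  · have h1 := chordPoly_mul_sub (hermiteH (n + 1)) a b r
    have h2 := chordPoly_derivative (hermiteH (n + 1)) a b r
    rw [h, mul_zero] at h1
    rw [h, h', mul_zero, add_zero, mul_zero, eval_derivative_hermiteH,
      eval_derivative_hermiteH] at h2
    refine hermiteH_transversal n hn (x := a * r) (y := b * r) ?_ (by linarith) ?_
    · simpa [hr] using heq
    · have h3 : 2 * ((n : ℝ) + 1) * (a * eval (a * r) (hermiteH n)
          - b * eval (b * r) (hermiteH n)) = 0 := by linarith
      have h4 := (mul_eq_zero.1 h3).resolve_left hn0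
      linear_combination r * h4

end HermiteChord

/-! ### Symmetric root lists, crossings and polar coordinates -/

/-- Reversing and negating a sorted symmetric list gives another sorted list of the same set. -/
lemma StrictMono.apply_rev_eq_neg {d : ℕ} {f : Fin d → ℝ} (hf : StrictMono f)
    (hneg : ∀ x ∈ range f, -x ∈ range f) (i : Fin d) : f i.rev = -f i := by
  have hg : StrictMono fun i : Fin d => -f i.rev := fun i j hij =>
    neg_lt_neg (hf (Fin.rev_lt_rev.2 hij))
  have hr : range f = range fun i : Fin d => -f i.rev := by
    ext x
    constructor
    · intro hx
      obtain ⟨j, hj⟩ := hneg x hx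
      exact ⟨j.rev, by simp [hj]⟩
    · rintro ⟨j, rfl⟩
      exact hneg _ ⟨_, rfl⟩
  have := congrFun (eq_of_strictMono_of_range_eq hf hg hr) i
  linarith

/-- A curve crosses a line where the defining function, up to a positive factor, has a simple
zero along the curve. -/
lemma crossesAt_of_hasDerivAt {γ : ℝ → ℝ × ℝ} {F : ℝ × ℝ → ℝ} {R c : ℝ → ℝ} {c' θ : ℝ}
    (hR : ∀ u, 0 < R u) (hF : ∀ u, F (γ u) = R u * c u) (h0 : c θ = 0)
    (hc : HasDerivAt c c' θ) (hc' : c' ≠ 0) : CrossesAt γ F (γ θ) := by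
  have hslope := hasDerivAt_iff_tendsto_slope.1 hc
  have hs : ∀ u, c u = (u - θ) * slope c θ u := fun u => by
    have := sub_smul_slope c θ u
    rw [h0] at this
    simpa using this.symm
  refine ⟨θ, rfl, by rw [hF, h0, mul_zero], ?_⟩
  rcases lt_or_gt_of_ne hc' with h | h
  · right
    have hev := hslope.eventually (gt_mem_nhds h)
    constructor
    · filter_upwards [nhdsWithin_mono θ (fun u (hu : u < θ) => hu.ne) hev,
        self_mem_nhdsWithin] with u h1 (h2 : u < θ)
      rw [hF, hs]
      exact mul_pos (hR u) (mul_pos_of_neg_of_neg (sub_neg.2 h2) h1)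
    · filter_upwards [nhdsWithin_mono θ (fun u (hu : θ < u) => hu.ne') hev,
        self_mem_nhdsWithin] with u h1 (h2 : θ < u)
      rw [hF, hs]
      exact mul_neg_of_pos_of_neg (hR u) (mul_neg_of_pos_of_neg (sub_pos.2 h2) h1)
  · left
    have hev := hslope.eventually (lt_mem_nhds h)
    constructor
    · filter_upwards [nhdsWithin_mono θ (fun u (hu : u < θ) => hu.ne) hev,
        self_mem_nhdsWithin] with u h1 (h2 : u < θ)
      rw [hF, hs]
      exact mul_neg_of_pos_of_neg (hR u) (mul_neg_of_neg_of_pos (sub_neg.2 h2) h1)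
    · filter_upwards [nhdsWithin_mono θ (fun u (hu : θ < u) => hu.ne') hev,
        self_mem_nhdsWithin] with u h1 (h2 : θ < u)
      rw [hF, hs]
      exact mul_pos (hR u) (mul_pos (sub_pos.2 h2) h1)

lemma polar_injective {r₁ r₂ θ₁ θ₂ : ℝ} (h₁ : 0 < r₁) (h₂ : 0 < r₂)
    (hx : r₁ * Real.cos θ₁ = r₂ * Real.cos θ₂) (hy : r₁ * Real.sin θ₁ = r₂ * Real.sin θ₂) :
    r₁ = r₂ ∧ Real.cos θ₁ = Real.cos θ₂ ∧ Real.sin θ₁ = Real.sin θ₂ := by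
  have hsq : r₁ ^ 2 = r₂ ^ 2 := by
    calc r₁ ^ 2 = (r₁ * Real.cos θ₁) ^ 2 + (r₁ * Real.sin θ₁) ^ 2 := by
          linear_combination -r₁ ^ 2 * Real.sin_sq_add_cos_sq θ₁
      _ = (r₂ * Real.cos θ₂) ^ 2 + (r₂ * Real.sin θ₂) ^ 2 := by rw [hx, hy]
      _ = r₂ ^ 2 := by linear_combination r₂ ^ 2 * Real.sin_sq_add_cos_sq θ₂
  have hr : r₁ = r₂ := (sq_eq_sq₀ h₁.le h₂.le).1 hsq
  subst hr
  exact ⟨rfl, mul_left_cancel₀ h₁.ne' hx, mul_left_cancel₀ h₁.ne' hy⟩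

lemma cos_ne_zero_or_sin_ne_zero (θ : ℝ) : Real.cos θ ≠ 0 ∨ Real.sin θ ≠ 0 := by
  by_contra! h
  have := Real.sin_sq_add_cos_sq θ
  simp [h.1, h.2] at this

/-! ### The closed curves and the nodal set -/

section Ovals

variable {n : ℕ}

/-- The zeros of `(H_{n+1}(x) - H_{n+1}(y)) / (x - y)` on the line of direction `θ` depend
continuously on `θ`. -/
lemma exists_polar_roots (hn : Odd (n + 1)) : ∃ ρ : ℝ → Fin n → ℝ, Continuous ρ ∧
    (∀ θ, StrictMono (ρ θ)) ∧ ∀ θ, range (ρ θ) =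
      {r | (chordPoly (hermiteH (n + 1)) (Real.cos θ) (Real.sin θ)).eval r = 0} := by
  have hnat : (hermiteH (n + 1)).natDegree = n + 1 := hermiteH_natDegree _
  have hdeg : ∀ θ, (chordPoly (hermiteH (n + 1)) (Real.cos θ) (Real.sin θ)).natDegree = n := by
    intro θ
    rw [chordPoly_natDegree _ _ _ (by rwa [hnat]) (cos_ne_zero_or_sin_ne_zero θ), hnat,
      Nat.add_sub_cancel]
  have hcont : ∀ k, Continuous fun θ =>
      (chordPoly (hermiteH (n + 1)) (Real.cos θ) (Real.sin θ)).coeff k := by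
    intro k
    simp only [chordPoly_coeff, powerChord]
    fun_prop
  have hne : ∀ θ, chordPoly (hermiteH (n + 1)) (Real.cos θ) (Real.sin θ) ≠ 0 := by
    intro θ h
    have := chordPoly_eval_zero (hermiteH (n + 1)) (Real.cos θ) (Real.sin θ)
    rw [h, Polynomial.eval_zero] at this
    exact hermiteH_coeff_one_ne_zero hn this.symm
  have hsimple : ∀ θ x, (chordPoly (hermiteH (n + 1)) (Real.cos θ) (Real.sin θ)).eval x = 0 →
      (Polynomial.derivative
        (chordPoly (hermiteH (n + 1)) (Real.cos θ) (Real.sin θ))).eval x ≠ 0 :=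
    fun θ _ h => chordPoly_hermiteH_simple hn (cos_ne_zero_or_sin_ne_zero θ) h
  obtain ⟨s, hs⟩ := exists_isHermiteZeros n
  have hq : (0 : ℝ) < √2 / 2 := by positivity
  -- On the diagonal the quotient is `H_{n+1}'`, so its roots are the zeros of `H_n` divided by `cos
  -- (π/4) = √2 / 2`.
  have hbase : IsSortedRoots
      (chordPoly (hermiteH (n + 1)) (Real.cos (Real.pi / 4)) (Real.sin (Real.pi / 4)))
      fun i => s i / (√2 / 2) := by
    rw [Real.cos_pi_div_four, Real.sin_pi_div_four]
    refine ⟨fun i j hij => div_lt_div_of_pos_right (hs.strictMono hij) hq, fun i => ?_⟩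
    rw [chordPoly_hermiteH_self_eq_zero_iff, mul_div_cancel₀ _ hq.ne']
    exact hs.range_eq.subset ⟨i, rfl⟩
  obtain ⟨ρ, hρ, hroots⟩ := exists_continuous_sortedRoots hdeg hcont hne hsimple hbase
  exact ⟨ρ, hρ, fun θ => (hroots θ).1, fun θ => (hroots θ).range_eq (hne θ) (hdeg θ)⟩

lemma chordPoly_hermiteH_self_eval_one (x : ℝ) :
    (chordPoly (hermiteH (n + 1)) x x).eval 1 = 0 ↔ (hermiteH n).eval x = 0 := by
  rw [chordPoly_hermiteH_self_eq_zero_iff, mul_one]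

lemma chordPoly_hermiteH_antidiagonal (hn : Odd (n + 1)) (x : ℝ) :
    (chordPoly (hermiteH (n + 1)) x (-x)).eval 1 = 0 ↔
      (hermiteH (n + 1)).eval x = 0 ∧ x ≠ 0 := by
  rcases eq_or_ne x 0 with rfl | hx
  · simp only [ne_eq, not_true_eq_false, and_false, iff_false, neg_zero]
    intro h
    have h0 := chordPoly_scale (hermiteH (n + 1)) 0 0 0
    rw [zero_mul, h, chordPoly_eval_zero] at h0
    exact hermiteH_coeff_one_ne_zero hn h0.symm
  · have h := chordPoly_mul_sub (hermiteH (n + 1)) x (-x) 1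
    rw [mul_one, mul_one, mul_one, hermiteH_eval_neg, hn.neg_one_pow] at h
    have h2 : x * (chordPoly (hermiteH (n + 1)) x (-x)).eval 1 = (hermiteH (n + 1)).eval x := by
      linarith
    rw [← h2]
    simp [hx]

lemma phi_sub_phi_eq_zero_iff (p : ℝ × ℝ) : phi (n + 1) 0 p - phi 0 (n + 1) p = 0 ↔
    p.1 = p.2 ∨ (chordPoly (hermiteH (n + 1)) p.1 p.2).eval 1 = 0 ∧ p.1 ≠ p.2 := by
  have h := chordPoly_mul_sub (hermiteH (n + 1)) p.1 p.2 1
  have hphi : phi (n + 1) 0 p - phi 0 (n + 1) p = (p.1 - p.2) *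
      (chordPoly (hermiteH (n + 1)) p.1 p.2).eval 1 * Real.exp (-(p.1 ^ 2 + p.2 ^ 2) / 2) := by
    simp only [mul_one] at h
    rw [h]
    simp only [phi, hermiteH, Polynomial.eval_one]
    ring
  rw [hphi, mul_eq_zero, or_iff_left (Real.exp_pos _).ne', mul_eq_zero, sub_eq_zero]
  tauto

lemma continuous_phi (m k : ℕ) : Continuous (phi m k) := by
  unfold phi
  fun_prop

/-- The zero set of `(H_{n+1}(x) - H_{n+1}(y)) / (x - y)` is a disjoint union of `n / 2` simple
closed curves, star-shaped about the origin and given in polar coordinates. -/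
lemma exists_polar_curves (hn : Odd (n + 1)) : ∃ R : Fin (n / 2) → ℝ → ℝ,
    (∀ k u, 0 < R k u) ∧
    (∀ k, IsSimpleClosedCurve fun u => (R k u * Real.cos u, R k u * Real.sin u)) ∧
    (∀ k l, k ≠ l → Disjoint (range fun u => (R k u * Real.cos u, R k u * Real.sin u))
      (range fun u => (R l u * Real.cos u, R l u * Real.sin u))) ∧
    (⋃ k, range fun u => (R k u * Real.cos u, R k u * Real.sin u)) =
      {p : ℝ × ℝ | (chordPoly (hermiteH (n + 1)) p.1 p.2).eval 1 = 0} := by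
  obtain ⟨ρ, hρ, hmono, hrange⟩ := exists_polar_roots hn
  have heven : n % 2 = 0 := by
    have := Nat.odd_iff.1 hn
    omega
  have hrev : ∀ θ i, ρ θ i.rev = -ρ θ i := fun θ =>
    (hmono θ).apply_rev_eq_neg fun x hx => by
      rw [hrange] at hx ⊢
      exact chordPoly_hermiteH_neg hn hx
  -- A root is positive iff it exceeds its opposite, which has index `n - 1 - i`; as `n` is even, no
  -- index is its own mirror image.
  have hpos : ∀ θ i, 0 < ρ θ i ↔ n / 2 ≤ i.val := by
    intro θ i
    have hlt : 0 < ρ θ i ↔ ρ θ i.rev < ρ θ i := by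
      rw [hrev]
      constructor <;> intro h <;> linarith
    rw [hlt, (hmono θ).lt_iff_lt, Fin.lt_def, Fin.val_rev]
    have := i.isLt
    omega
  have hcongr : ∀ θ₁ θ₂, Real.cos θ₁ = Real.cos θ₂ → Real.sin θ₁ = Real.sin θ₂ →
      ρ θ₁ = ρ θ₂ := fun θ₁ θ₂ hc hs =>
    eq_of_strictMono_of_range_eq (hmono θ₁) (hmono θ₂) (by rw [hrange, hrange, hc, hs])
  let idx : Fin (n / 2) → Fin n := fun k => ⟨n / 2 + k, by omega⟩
  have hR : ∀ k u, 0 < ρ u (idx k) := fun k u => (hpos _ _).2 (Nat.le_add_right _ _)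
  refine ⟨fun k u => ρ u (idx k), hR, fun k => ⟨?_, ?_, ?_⟩, ?_, ?_⟩
  · have := (continuous_apply (idx k)).comp hρ
    simp only [Function.comp_def] at this
    fun_prop
  · intro u
    simp only
    rw [hcongr (u + 2 * Real.pi) u (Real.cos_add_two_pi u) (Real.sin_add_two_pi u),
      Real.cos_add_two_pi, Real.sin_add_two_pi]
  · intro u hu v hv huv
    obtain ⟨hx, hy⟩ := Prod.mk.inj huv
    obtain ⟨-, hc, hs⟩ := polar_injective (hR k u) (hR k v) hx hy
    -- The angles differ by `2πj`, and both lie in `[0, 2π)`, so `j = 0`.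
    obtain ⟨j, hj⟩ := Real.Angle.angle_eq_iff_two_pi_dvd_sub.1 (Real.Angle.cos_sin_inj hc hs)
    have hpi := Real.pi_pos
    have h1 : (j : ℝ) < 1 := by
      by_contra! h
      nlinarith [hu.2, hv.1]
    have h2 : (-1 : ℝ) < j := by
      by_contra! h
      nlinarith [hu.1, hv.2]
    have hj0 : j = 0 := by
      have h1' : j < 1 := by exact_mod_cast h1
      have h2' : -1 < j := by exact_mod_cast h2
      omega
    rw [hj0, Int.cast_zero, mul_zero] at hj
    linarith
  · intro k l hkl
    rw [Set.disjoint_left]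
    rintro _ ⟨u, rfl⟩ ⟨v, huv⟩
    obtain ⟨hx, hy⟩ := Prod.mk.inj huv
    obtain ⟨hr, hc, hs⟩ := polar_injective (hR l v) (hR k u) hx hy
    rw [hcongr v u hc hs] at hr
    have := congrArg Fin.val ((hmono u).injective hr)
    simp only [idx] at this
    exact hkl (Fin.ext (by omega))
  · ext ⟨x, y⟩
    simp only [mem_iUnion, mem_range, mem_ofPred_eq]
    constructor
    · rintro ⟨k, u, huv⟩
      obtain ⟨rfl, rfl⟩ := Prod.mk.inj huv
      rw [mul_comm _ (Real.cos u), mul_comm _ (Real.sin u), chordPoly_scale]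
      exact (hrange u).subset ⟨_, rfl⟩
    · intro h
      have hxy : (⟨x, y⟩ : ℂ) ≠ 0 := by
        intro h0
        have hx : x = 0 := congrArg Complex.re h0
        have hy : y = 0 := congrArg Complex.im h0
        have := (chordPoly_hermiteH_antidiagonal hn 0).1 (by simpa [hx, hy] using h)
        exact this.2 rfl
      set u := Complex.arg ⟨x, y⟩
      set r := ‖(⟨x, y⟩ : ℂ)‖
      have hr : 0 < r := norm_pos_iff.2 hxy
      have hx : x = Real.cos u * r := by
        rw [mul_comm, Complex.norm_mul_cos_arg]
      have hy : y = Real.sin u * r := by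
        rw [mul_comm, Complex.norm_mul_sin_arg]
      rw [hx, hy, chordPoly_scale] at h
      obtain ⟨i, hi⟩ := (hrange u).superset h
      have hle : n / 2 ≤ i.val := (hpos u i).1 (hi ▸ hr)
      have hlt := i.isLt
      refine ⟨⟨i.val - n / 2, by omega⟩, u, ?_⟩
      have hidx : idx ⟨i.val - n / 2, by omega⟩ = i := Fin.ext (by simp only [idx]; omega)
      rw [hidx, hi, mul_comm r, mul_comm r, ← hx, ← hy]

end Ovals

/-! ### Assembly of the proposition -/

theorem proposition4p1 (n : ℕ) (hn : Odd n) :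
    ∃ (s : Fin (n - 1) → ℝ) (t : Fin n → ℝ) (γ : Fin ((n - 1) / 2) → ℝ → ℝ × ℝ),
      -- the zeros of `H_{n-1}` and of `H_n`, in increasing order
      IsHermiteZeros (n - 1) s ∧ IsHermiteZeros n t ∧
      -- the nodal set is the diagonal together with pairwise disjoint simple closed curves
      (∀ k, IsSimpleClosedCurve (γ k)) ∧
      (∀ k l, k ≠ l → Disjoint (range (γ k)) (range (γ l))) ∧
      nodalSet (fun p => phi n 0 p - phi 0 n p) =
        {p : ℝ × ℝ | p.1 = p.2} ∪ (⋃ k, range (γ k)) ∧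
      -- the points of the curves on the diagonal, and on the anti-diagonal
      (⋃ k, range (γ k)) ∩ {p : ℝ × ℝ | p.1 = p.2} = range (fun i => (s i, s i)) ∧
      (⋃ k, range (γ k)) ∩ {p : ℝ × ℝ | p.1 + p.2 = 0} =
        (fun i => (t i, -t i)) '' {i | t i ≠ 0} ∧
      -- there are `n - 1` points of either kind
      (range (fun i => (s i, s i))).ncard = n - 1 ∧
      ((fun i => (t i, -t i)) '' {i | t i ≠ 0}).ncard = n - 1 ∧
      -- the curves cross the two lines at these points
      (∀ i, ∃ k, CrossesAt (γ k) (fun p => p.1 - p.2) (s i, s i)) ∧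
      (∀ i, t i ≠ 0 → ∃ k, CrossesAt (γ k) (fun p => p.1 + p.2) (t i, -t i)) ∧
      -- every curve crosses both lines
      (∀ k, ∃ i, CrossesAt (γ k) (fun p => p.1 - p.2) (s i, s i)) ∧
      (∀ k, ∃ i, t i ≠ 0 ∧ CrossesAt (γ k) (fun p => p.1 + p.2) (t i, -t i)) := by
  obtain ⟨n, rfl⟩ : ∃ m, n = m + 1 := ⟨n - 1, by have := hn.pos; omega⟩
  simp only [Nat.add_sub_cancel]
  obtain ⟨s, hs⟩ := exists_isHermiteZeros n
  obtain ⟨t, ht⟩ := exists_isHermiteZeros (n + 1)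
  obtain ⟨R, hR, hcurve, hdisj, hunion⟩ := exists_polar_curves hn
  have hdiag : (⋃ k, range fun u => (R k u * Real.cos u, R k u * Real.sin u)) ∩
      {p : ℝ × ℝ | p.1 = p.2} = range (fun i => (s i, s i)) := by
    rw [hunion]
    ext ⟨x, y⟩
    have hx := Set.ext_iff.1 hs.range_eq x
    simp only [mem_inter_iff, mem_ofPred_eq, mem_range, Prod.mk.injEq] at hx ⊢
    constructor
    · rintro ⟨h, rfl⟩
      obtain ⟨i, hi⟩ := hx.2 ((chordPoly_hermiteH_self_eval_one x).1 h)
      exact ⟨i, hi, hi⟩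
    · rintro ⟨i, hi, hi'⟩
      obtain rfl : x = y := hi.symm.trans hi'
      exact ⟨(chordPoly_hermiteH_self_eval_one x).2 (hx.1 ⟨i, hi⟩), rfl⟩
  have hanti : (⋃ k, range fun u => (R k u * Real.cos u, R k u * Real.sin u)) ∩
      {p : ℝ × ℝ | p.1 + p.2 = 0} = (fun i => (t i, -t i)) '' {i | t i ≠ 0} := by
    rw [hunion]
    ext ⟨x, y⟩
    have hx := Set.ext_iff.1 ht.range_eq x
    simp only [mem_inter_iff, mem_ofPred_eq, mem_range, mem_image, Prod.mk.injEq] at hx ⊢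
    constructor
    · rintro ⟨h, hxy⟩
      obtain rfl : y = -x := by linarith
      obtain ⟨h1, h2⟩ := (chordPoly_hermiteH_antidiagonal hn x).1 h
      obtain ⟨i, rfl⟩ := hx.2 h1
      exact ⟨i, h2, rfl, rfl⟩
    · rintro ⟨i, h0, rfl, rfl⟩
      exact ⟨(chordPoly_hermiteH_antidiagonal hn _).2 ⟨hx.1 ⟨i, rfl⟩, h0⟩, add_neg_cancel _⟩
  have hcross_diag : ∀ k u, R k u * Real.cos u = R k u * Real.sin u →
      CrossesAt (fun u => (R k u * Real.cos u, R k u * Real.sin u)) (fun p => p.1 - p.2)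
        (R k u * Real.cos u, R k u * Real.sin u) := by
    intro k u h
    have heq := mul_left_cancel₀ (hR k u).ne' h
    refine crossesAt_of_hasDerivAt (γ := fun u => (R k u * Real.cos u, R k u * Real.sin u))
      (hR k) (c := fun u => Real.cos u - Real.sin u) (fun u => (mul_sub _ _ _).symm)
      (sub_eq_zero.2 heq) ((Real.hasDerivAt_cos u).sub (Real.hasDerivAt_sin u)) ?_
    intro h0
    -- `cos u - sin u` and its derivative `-sin u - cos u` vanish together only if both `cos u` and
    -- `sin u` do.
    rcases cos_ne_zero_or_sin_ne_zero u with h | h <;> apply h <;> linarith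
  have hcross_anti : ∀ k u, R k u * Real.cos u + R k u * Real.sin u = 0 →
      CrossesAt (fun u => (R k u * Real.cos u, R k u * Real.sin u)) (fun p => p.1 + p.2)
        (R k u * Real.cos u, R k u * Real.sin u) := by
    intro k u h
    rw [← mul_add] at h
    have heq := (mul_eq_zero.1 h).resolve_left (hR k u).ne'
    refine crossesAt_of_hasDerivAt (γ := fun u => (R k u * Real.cos u, R k u * Real.sin u))
      (hR k) (c := fun u => Real.cos u + Real.sin u) (fun u => (mul_add _ _ _).symm)
      heq ((Real.hasDerivAt_cos u).add (Real.hasDerivAt_sin u)) ?_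
    intro h0
    rcases cos_ne_zero_or_sin_ne_zero u with h | h <;> apply h <;> linarith
  have hcard : (range fun i => (s i, s i)).ncard = n := by
    have hinj : Function.Injective fun i => (s i, s i) := fun i j h =>
      hs.strictMono.injective (Prod.mk.inj h).1
    rw [← image_univ, ncard_image_of_injective _ hinj, ncard_univ, Nat.card_fin]
  refine ⟨s, t, fun k u => (R k u * Real.cos u, R k u * Real.sin u), hs, ht, hcurve, hdisj,
    ?_, hdiag, hanti, hcard, ?_, ?_, ?_, ?_, ?_⟩
  · have hclosed : IsClosed {p : ℝ × ℝ | phi (n + 1) 0 p - phi 0 (n + 1) p = 0} :=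
      isClosed_eq ((continuous_phi _ _).sub (continuous_phi _ _)) continuous_const
    rw [nodalSet, hclosed.closure_eq]
    refine Eq.trans ?_ (congrArg ({p : ℝ × ℝ | p.1 = p.2} ∪ ·) hunion.symm)
    ext p
    simp only [mem_ofPred_eq, mem_union, phi_sub_phi_eq_zero_iff]
    tauto
  -- Oddness makes `0` a zero of `H_{n+1}`, so exactly one of the `n + 1` indices is discarded.
  · obtain ⟨i₀, hi₀⟩ : (0 : ℝ) ∈ range t := by
      rw [ht.range_eq, mem_ofPred_eq]
      have := hermiteH_eval_neg (n + 1) 0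
      rw [hn.neg_one_pow, neg_zero] at this
      linarith
    have hset : {i | t i ≠ 0} = {i₀}ᶜ := by
      ext i
      rw [mem_ofPred_eq, mem_compl_singleton_iff, ← hi₀, ht.strictMono.injective.ne_iff]
    have hinj : Function.Injective fun i => (t i, -t i) := fun i j h =>
      ht.strictMono.injective (Prod.mk.inj h).1
    rw [ncard_image_of_injective _ hinj, hset,
      ncard_compl, ncard_singleton, Nat.card_fin, Nat.add_sub_cancel]
  · intro i
    have hmem := (hdiag.superset ⟨i, rfl⟩).1
    obtain ⟨k, u, hu⟩ := mem_iUnion.1 hmem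
    obtain ⟨hx, hy⟩ := Prod.mk.inj hu
    exact ⟨k, by simpa only [hx, hy] using hcross_diag k u (hx.trans hy.symm)⟩
  · intro i hi
    have hmem := (hanti.superset ⟨i, hi, rfl⟩).1
    obtain ⟨k, u, hu⟩ := mem_iUnion.1 hmem
    obtain ⟨hx, hy⟩ := Prod.mk.inj hu
    exact ⟨k, by simpa only [hx, hy] using hcross_anti k u (by rw [hx, hy, add_neg_cancel])⟩
  · intro k
    -- Each polar curve has a point in every direction: angle `π/4` serves for the diagonal, `-π/4`
    -- for the anti-diagonal.
    have heq : R k (Real.pi / 4) * Real.cos (Real.pi / 4)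
        = R k (Real.pi / 4) * Real.sin (Real.pi / 4) := by
      rw [Real.cos_pi_div_four, Real.sin_pi_div_four]
    obtain ⟨i, hi⟩ := hdiag.subset ⟨mem_iUnion.2 ⟨k, Real.pi / 4, rfl⟩, heq⟩
    exact ⟨i, by simpa only [hi] using hcross_diag k _ heq⟩
  · intro k
    have heq : R k (-(Real.pi / 4)) * Real.cos (-(Real.pi / 4))
        + R k (-(Real.pi / 4)) * Real.sin (-(Real.pi / 4)) = 0 := by
      rw [Real.cos_neg, Real.sin_neg, Real.cos_pi_div_four, Real.sin_pi_div_four]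
      ring
    obtain ⟨i, hi, hi'⟩ := hanti.subset ⟨mem_iUnion.2 ⟨k, -(Real.pi / 4), rfl⟩, heq⟩
    exact ⟨i, hi, by simpa only [hi'] using hcross_anti k _ heq⟩
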